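/- Let $d\ge 1$, let $\mathcal{A}$ be a finite alphabet, let $R=\prod_{i=1}^{d}[0,L_i-1]\subset\mathbb{Z}^d$ with integers $L_i\ge 2$, and let $\varrho\colon\mathcal{A}\to\mathcal{A}^{R}$ be a $d$-dimensional rectangular substitution. For $k\ge 0$ let $\varrho^{k}(a)$ be the $k$-fold iterate on the letter $a$: this is a pattern on $\prod_{i}[0,L_i^{k}-1]$, with $\varrho^0(a)=a$, and $\varrho^{k+1}(a)$ is obtained from $\varrho^k(a)$ by replacing the letter $b$ at each position $(m_1,\dots,m_d)$ by the block $\varrho(b)$ placed on $\prod_i [m_iL_i,\,m_iL_i+L_i-1]$. Assume that * $\varrho$ is bijective: for every $\boldsymbol r\in R$ the column $\varrho_{\boldsymbol r}\colon a\mapsto\varrho(a)_{\boldsymbol r}$ is a bijection of $\mathcal{A}$; * $\varrho$ is primitive: there is $k\ge 1$ such that $\varrho^{k}(a)$ contains every letter of $\mathcal{A}$, for every $a\in\mathcal{A}$. Call a finite rectangular pattern legal if, up to translation, it is a subpattern of $\varrho^{k}(a)$ for some $k\ge 1$ and $a\in\mathcal{A}$, and let the hull $\mathbb{X}_{\varrho}\subseteq\mathcal{A}^{\mathbb{Z}^d}$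 be the set of all configurations $x\colon\mathbb{Z}^d\to\mathcal{A}$ all of whose finite rectangular subpatterns are legal. If there exist two legal blocks $u,v\in\mathcal{A}^{\{0,1\}^{d}}$ (of side length $2$ in each direction) which disagree at exactly one position and coincide at all other positions, then $\mathbb{X}_{\varrho}$ is aperiodic: for no $x\in\mathbb{X}_{\varrho}$ is there a vector $\boldsymbol n\in\mathbb{Z}^{d}\setminus\{\boldsymbol 0\}$ with $x_{\boldsymbol n+\boldsymbol m}=x_{\boldsymbol m}$ for all $\boldsymbol m\in\mathbb{Z}^{d}$. -/

import Mathlib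

/-- A `d`-dimensional rectangular substitution `ϱ : A → A^R` on the alphabet `A`, with
`R = ∏ i, [0, L i - 1]` and all side lengths `L i ≥ 2`. -/
structure RectSubst (d : ℕ) (A : Type*) where
  /-- the side lengths `L i` of the rectangle `R` -/
  L : Fin d → ℕ
  two_le_L : ∀ i, 2 ≤ L i
  /-- `image a r` is the letter `ϱ(a)_r` at position `r ∈ R` of the block `ϱ(a)` -/
  image : A → (∀ i, Fin (L i)) → A

namespace RectSubst

variable {d : ℕ} {A : Type*}

/-- `ϱ` is bijective: every column `ϱ_r : a ↦ ϱ(a)_r` is a bijection of the alphabet. -/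
def IsBijective (ϱ : RectSubst d A) : Prop :=
  ∀ r : ∀ i, Fin (ϱ.L i), Function.Bijective fun a => ϱ.image a r

/-- The substitution applied to a rectangular pattern `P` of shape `∏ i, [0, M i - 1]`:
the letter of `P` at position `m` is replaced by its image block, placed at
`∏ i, [m i * L i, m i * L i + L i - 1]`. -/
def applyPattern (ϱ : RectSubst d A) {M : Fin d → ℕ} (P : (∀ i, Fin (M i)) → A) :
    (∀ i, Fin (M i * ϱ.L i)) → A :=
  fun n => ϱ.image (P fun i => (n i).divNat) fun i => (n i).modNat

/-- The block `ϱ^k(a)`, a pattern of shape `∏ i, [0, (L i)^k - 1]`. -/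
def iter (ϱ : RectSubst d A) : (k : ℕ) → A → (∀ i, Fin (ϱ.L i ^ k)) → A
  | 0, a => fun _ => a
  | k + 1, a => ϱ.applyPattern (ϱ.iter k a)

/-- `ϱ` is primitive: for some power `k ≥ 1`, each `ϱ^k(a)` contains all letters. -/
def IsPrimitive (ϱ : RectSubst d A) : Prop :=
  ∃ k : ℕ, 1 ≤ k ∧ ∀ a b : A, ∃ n, ϱ.iter k a n = b

/-- A rectangular pattern `P` of shape `∏ i, [0, M i - 1]` is legal (it lies in the language of
`ϱ`) if some translate of it is a subpattern of some `ϱ^k(a)` with `k ≥ 1`. -/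
def IsLegal (ϱ : RectSubst d A) {M : Fin d → ℕ} (P : (∀ i, Fin (M i)) → A) : Prop :=
  ∃ (k : ℕ) (_ : 1 ≤ k) (a : A) (t : Fin d → ℕ) (ht : ∀ i, t i + M i ≤ ϱ.L i ^ k),
    ∀ n : ∀ i, Fin (M i),
      P n = ϱ.iter k a fun i =>
        ⟨t i + n i, (Nat.add_lt_add_left (n i).isLt (t i)).trans_le (ht i)⟩

/-- The hull (substitutive subshift) of `ϱ`: all configurations on `ℤ^d` all of whose rectangular
subpatterns are legal. -/
def hull (ϱ : RectSubst d A) : Set ((Fin d → ℤ) → A) :=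
  {x | ∀ (M : Fin d → ℕ) (t : Fin d → ℤ),
    ϱ.IsLegal fun n : ∀ i, Fin (M i) => x fun i => t i + ((n i : ℕ) : ℤ)}

end RectSubst

/-- The shift action of `ℤ^d` on configurations, `(σ_n x)_m = x_{n+m}`. -/
def shiftConf {d : ℕ} {A : Type*} (n : Fin d → ℤ) (x : (Fin d → ℤ) → A) : (Fin d → ℤ) → A :=
  fun m => x (n + m)

/-- A set of configurations on `ℤ^d` is aperiodic if none of its elements has a non-zero period,
in any direction. -/
def IsAperiodic {d : ℕ} {A : Type*} (X : Set ((Fin d → ℤ) → A)) : Prop :=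
  ∀ x ∈ X, ∀ n : Fin d → ℤ, shiftConf n x = x → n = 0

/-! Suppose `x` has a period `n ≠ 0`, and take `K` with `|n i| < L i ^ K` for all `i`. By
primitivity `x` contains `ϱ^K(u)` and `ϱ^K(v)`, each made of `2 ^ d` boxes, which agree off the box
`j` where `u` and `v` differ. Moving by `n` or `-n` takes the corner of box `j` nearest the centre
into another box (`exists_move_innermost_corner`), where the two patterns agree. Periodicity makes
them agree at that corner too, and injectivity of the columns of `ϱ^K` forces `u j = v j`, a
contradiction. -/

namespace RectSubst

variable {d : ℕ} {A : Type*}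

/-- The letters of `ϱ^k(a)`, extended `L ^ k`-periodically to all positions in `ℕ^d`. -/
def letterAt (ϱ : RectSubst d A) : ℕ → A → (Fin d → ℕ) → A
  | 0, a, _ => a
  | k + 1, a, p => ϱ.image (letterAt ϱ k a fun i => p i / ϱ.L i)
      fun i => ⟨p i % ϱ.L i, Nat.mod_lt _ (two_pos.trans_le (ϱ.two_le_L i))⟩

theorem L_pos (ϱ : RectSubst d A) (i : Fin d) : 0 < ϱ.L i :=
  two_pos.trans_le (ϱ.two_le_L i)

theorem iter_eq_letterAt (ϱ : RectSubst d A) (k : ℕ) (a : A) (n : ∀ i, Fin (ϱ.L i ^ k)) :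
    ϱ.iter k a n = ϱ.letterAt k a fun i => n i := by
  induction k with
  | zero => rfl
  | succ k ih =>
    change ϱ.image (ϱ.iter k a _) _ = _
    rw [ih]
    rfl

/-- `ϱ^(k+m)(a)` is obtained by applying `ϱ^m` to the letters of `ϱ^k(a)`. -/
theorem letterAt_add (ϱ : RectSubst d A) (k m : ℕ) (a : A) (p : Fin d → ℕ) :
    ϱ.letterAt (k + m) a p = ϱ.letterAt m (ϱ.letterAt k a fun i => p i / ϱ.L i ^ m) p := by
  induction m generalizing p with
  | zero => simp [letterAt]
  | succ m ih =>
    change ϱ.image (ϱ.letterAt (k + m) a _) _ = _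
    rw [ih]
    simp only [letterAt, Nat.div_div_eq_div_mul, pow_succ']

/-- Only the `k` lowest base-`L i` digits of each coordinate are ever read. -/
theorem letterAt_add_mul (ϱ : RectSubst d A) (k : ℕ) (a : A) (p q : Fin d → ℕ) :
    ϱ.letterAt k a (fun i => p i + ϱ.L i ^ k * q i) = ϱ.letterAt k a p := by
  induction k generalizing p with
  | zero => rfl
  | succ k ih =>
    have h1 : (fun i => (p i + ϱ.L i ^ (k + 1) * q i) / ϱ.L i) =
        fun i => p i / ϱ.L i + ϱ.L i ^ k * q i := by
      funext i
      rw [pow_succ', mul_assoc, Nat.add_mul_div_left _ _ (ϱ.L_pos i)]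
    have h2 : ∀ i, (p i + ϱ.L i ^ (k + 1) * q i) % ϱ.L i = p i % ϱ.L i := by
      intro i
      rw [pow_succ', mul_assoc, Nat.add_mul_mod_self_left]
    simp only [letterAt, h1, h2, ih]

/-- Each column of `ϱ^k` is a composition of `k` columns of `ϱ`. -/
theorem IsBijective.letterAt_injective {ϱ : RectSubst d A} (h : ϱ.IsBijective) (k : ℕ)
    (p : Fin d → ℕ) : Function.Injective fun a => ϱ.letterAt k a p := by
  induction k generalizing p with
  | zero => exact fun _ _ hab => hab
  | succ k ih => exact (h _).injective.comp (ih _)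

/-- Every element of the hull of a primitive substitution contains every block `ϱ^k(a)`. -/
theorem IsPrimitive.exists_occurrence [Nonempty (Fin d)] {ϱ : RectSubst d A} (h : ϱ.IsPrimitive)
    {x : (Fin d → ℤ) → A} (hx : x ∈ ϱ.hull) (k : ℕ) (a : A) :
    ∃ s : Fin d → ℤ, ∀ p : Fin d → ℕ, (∀ i, p i < ϱ.L i ^ k) →
      x (fun i => s i + p i) = ϱ.letterAt k a p := by
  obtain ⟨k₀, -, hk₀⟩ := h
  -- A window of side `2 * B` contains a box of side `B` aligned to the grid of multiples of `B`,
  -- wherever it sits; here `B = L i ^ (k₀ + k)`.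
  obtain ⟨q, -, c, t, ht, hxt⟩ := hx (fun i => 2 * ϱ.L i ^ (k₀ + k)) 0
  have hpos : ∀ i m, 0 < ϱ.L i ^ m := fun i m => pow_pos (ϱ.L_pos i) m
  have hq : k₀ + k ≤ q := by
    obtain ⟨i⟩ := ‹Nonempty (Fin d)›
    by_contra! hlt
    have h1 := Nat.pow_le_pow_right (ϱ.L_pos i) hlt.le
    have h2 : t i + 2 * ϱ.L i ^ (k₀ + k) ≤ ϱ.L i ^ q := ht i
    have h3 := hpos i (k₀ + k)
    omega
  obtain ⟨r, rfl⟩ := Nat.exists_eq_add_of_le' hq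
  -- Grid index of the first aligned box starting after `t`. That box carries `ϱ^(k₀+k)` of the
  -- letter of `ϱ^r(c)` at `w`, and `ϱ^k₀` of this letter contains `a`.
  let w : Fin d → ℕ := fun i => t i / ϱ.L i ^ (k₀ + k) + 1
  have hw : ∀ i, t i < ϱ.L i ^ (k₀ + k) * w i ∧
      ϱ.L i ^ (k₀ + k) * w i ≤ t i + ϱ.L i ^ (k₀ + k) := fun i =>
    ⟨Nat.lt_mul_div_succ _ (hpos i _), by
      have := Nat.mul_div_le (t i) (ϱ.L i ^ (k₀ + k))
      simp only [w, mul_add, mul_one]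
      omega⟩
  obtain ⟨n, hn⟩ := hk₀ (ϱ.letterAt r c w) a
  rw [iter_eq_letterAt] at hn
  refine ⟨fun i => ϱ.L i ^ (k₀ + k) * w i - t i + ϱ.L i ^ k * (n i : ℕ), fun p hp => ?_⟩
  have hy : ∀ i, p i + ϱ.L i ^ k * n i < ϱ.L i ^ (k₀ + k) := fun i => by
    have h1 : ϱ.L i ^ k * ((n i : ℕ) + 1) ≤ ϱ.L i ^ k * ϱ.L i ^ k₀ :=
      Nat.mul_le_mul_left _ (n i).isLt
    rw [pow_add, mul_comm (ϱ.L i ^ k₀)]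
    have h2 := hp i
    rw [mul_add] at h1
    omega
  have key := hxt fun i => ⟨ϱ.L i ^ (k₀ + k) * w i - t i + (p i + ϱ.L i ^ k * n i), by
    have h1 := hw i
    have h2 := hy i
    change _ < 2 * ϱ.L i ^ (k₀ + k)
    omega⟩
  rw [iter_eq_letterAt] at key
  have e1 : (fun i => t i + (ϱ.L i ^ (k₀ + k) * w i - t i + (p i + ϱ.L i ^ k * n i))) =
      fun i => p i + ϱ.L i ^ k * n i + ϱ.L i ^ (k₀ + k) * w i := by
    funext i
    have := hw i
    omega
  have e2 : (fun i => (p i + ϱ.L i ^ k * n i + ϱ.L i ^ (k₀ + k) * w i) / ϱ.L i ^ (k₀ + k)) =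
      w := by
    funext i
    rw [Nat.add_mul_div_left _ _ (hpos i _), Nat.div_eq_of_lt (hy i), zero_add]
  have e3 : (fun i => (p i + ϱ.L i ^ k * n i) / ϱ.L i ^ k) = fun i => (n i : ℕ) := by
    funext i
    rw [Nat.add_mul_div_left _ _ (hpos i _), Nat.div_eq_of_lt (hp i), zero_add]
  simp only [e1] at key
  rw [letterAt_add, e2, letterAt_add_mul, letterAt_add, e3, hn, letterAt_add_mul] at key
  rw [← key]
  congr 1
  funext i
  push_cast [Nat.cast_sub (hw i).1.le]
  simp only [Pi.zero_apply]
  ring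

/-- Every element of the hull of a primitive substitution contains the image `ϱ^K(u)` of every
legal block `u` of side length two. -/
theorem IsPrimitive.exists_occurrence_of_isLegal [Nonempty (Fin d)] {ϱ : RectSubst d A}
    (h : ϱ.IsPrimitive) {x : (Fin d → ℤ) → A} (hx : x ∈ ϱ.hull) {u : (Fin d → Fin 2) → A}
    (hu : ϱ.IsLegal (M := fun _ => 2) u) (K : ℕ) :
    ∃ s : Fin d → ℤ, ∀ (j : Fin d → Fin 2) (p : Fin d → ℕ), (∀ i, p i / ϱ.L i ^ K = j i) →
      x (fun i => s i + p i) = ϱ.letterAt K (u j) p := by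
  obtain ⟨k, -, a, t, ht, hut⟩ := hu
  obtain ⟨s, hs⟩ := h.exists_occurrence hx (k + K) a
  have hpos : ∀ i, 0 < ϱ.L i ^ K := fun i => pow_pos (ϱ.L_pos i) K
  refine ⟨fun i => s i + ϱ.L i ^ K * t i, fun j p hp => ?_⟩
  have hdiv : ∀ i, (p i + ϱ.L i ^ K * t i) / ϱ.L i ^ K = t i + j i := fun i => by
    rw [Nat.add_mul_div_left _ _ (hpos i), hp, add_comm]
  have key := hs (fun i => p i + ϱ.L i ^ K * t i) fun i => by
    rw [pow_add, ← Nat.div_lt_iff_lt_mul (hpos i), hdiv]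
    exact (Nat.add_lt_add_left (j i).isLt (t i)).trans_le (ht i)
  rw [letterAt_add, letterAt_add_mul] at key
  simp only [hdiv] at key
  rw [hut j, iter_eq_letterAt, ← key]
  congr 1
  funext i
  push_cast
  ring

end RectSubst

/-- A nonzero vector or its negative moves the innermost corner of the sub-box `j` of the box
`∏ i, [0, 2 * B i - 1]` to a different sub-box. -/
theorem exists_move_innermost_corner {d : ℕ} (B : Fin d → ℕ) (n : Fin d → ℤ)
    (hB : ∀ i, (n i).natAbs < B i) (hn : n ≠ 0) (j : Fin d → Fin 2) :
    ∃ (y y' : Fin d → ℕ) (j' : Fin d → Fin 2), j' ≠ j ∧ (∀ i, y i / B i = j i) ∧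
      (∀ i, y' i / B i = j' i) ∧
      ((∀ i, (y' i : ℤ) = n i + y i) ∨ ∀ i, (y i : ℤ) = n i + y' i) := by
  -- Choosing the sign so that the `i`-th coordinate leaves the sub-box.
  have main : ∀ n' : Fin d → ℤ, (∀ i, (n' i).natAbs < B i) → ∀ i₀ : Fin d,
      (j i₀ = 0 ∧ 0 < n' i₀ ∨ j i₀ = 1 ∧ n' i₀ < 0) →
      ∃ (y y' : Fin d → ℕ) (j' : Fin d → Fin 2), j' ≠ j ∧ (∀ i, y i / B i = j i) ∧
        (∀ i, y' i / B i = j' i) ∧ ∀ i, (y' i : ℤ) = n' i + y i := by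
    intro n' hB i₀ hi₀
    have hpos : ∀ i, 0 < B i := fun i => (Nat.zero_le _).trans_lt (hB i)
    -- The innermost corner lies next to the boundary with the other half in every coordinate, so
    -- any step towards that half crosses it.
    let y : Fin d → ℕ := fun i => if j i = 0 then B i - 1 else B i
    have hy : ∀ i, (j i = 0 ∧ y i = B i - 1) ∨ (j i = 1 ∧ y i = B i) := fun i => by
      have hj : j i = 0 ∨ j i = 1 := by omega
      rcases hj with hj | hj <;> simp [y, hj]
    -- No truncation occurs in `toNat`: `y i ≥ B i - 1 ≥ |n' i|`.
    let y' : Fin d → ℕ := fun i => (n' i + y i).toNat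
    have hy' : ∀ i, (y' i : ℤ) = n' i + y i := fun i => by
      have h1 := hy i
      have h2 := hB i
      simp only [y']
      omega
    have hlt : ∀ i, y' i < 2 * B i := fun i => by
      have h1 := hy i
      have h2 := hB i
      have h3 := hy' i
      omega
    refine ⟨y, y', fun i => ⟨y' i / B i, (Nat.div_lt_iff_lt_mul (hpos i)).2 (hlt i)⟩, ?_, ?_,
      fun i => rfl, hy'⟩
    · intro he
      have h0 : y' i₀ / B i₀ = j i₀ := congrArg Fin.val (congrFun he i₀)
      have h1 := hy i₀
      have h2 := hB i₀
      have h3 := hy' i₀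
      rcases hi₀ with ⟨hj, hn'⟩ | ⟨hj, hn'⟩
      · rw [hj, Fin.val_zero, Nat.div_eq_zero_iff] at h0
        simp only [hj, zero_ne_one, false_and, or_false, true_and] at h1
        omega
      · have h4 : y' i₀ / B i₀ = 0 := Nat.div_eq_of_lt (by
          simp only [hj, one_ne_zero, false_and, false_or, true_and] at h1
          omega)
        rw [h4, hj] at h0
        exact absurd h0 (by decide)
    · intro i
      rcases hy i with ⟨hj, h⟩ | ⟨hj, h⟩
      · rw [hj, h]
        exact Nat.div_eq_of_lt (Nat.sub_lt (hpos i) one_pos)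
      · rw [hj, h]
        exact Nat.div_self (hpos i)
  obtain ⟨i₀, hi₀⟩ := Function.ne_iff.1 hn
  have hj : j i₀ = 0 ∨ j i₀ = 1 := by omega
  rw [Pi.zero_apply] at hi₀
  by_cases hc : j i₀ = 0 ∧ 0 < n i₀ ∨ j i₀ = 1 ∧ n i₀ < 0
  · obtain ⟨y, y', j', h1, h2, h3, h4⟩ := main n hB i₀ hc
    exact ⟨y, y', j', h1, h2, h3, Or.inl h4⟩
  -- Here `n i₀` points away from the other half, so `-n i₀` points towards it.
  · obtain ⟨y, y', j', h1, h2, h3, h4⟩ := main (fun i => -n i) (fun i => by simpa using hB i) i₀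
      (by rcases hj with hj | hj <;> simp [hj] at hc ⊢ <;> omega)
    exact ⟨y, y', j', h1, h2, h3, Or.inr fun i => by linarith [h4 i]⟩

theorem mainTheorem10 {d : ℕ} {A : Type*} [Finite A] (ϱ : RectSubst d A)
    (hbij : ϱ.IsBijective) (hprim : ϱ.IsPrimitive)
    (u v : (Fin d → Fin 2) → A)
    (hu : ϱ.IsLegal (M := fun _ => 2) u) (hv : ϱ.IsLegal (M := fun _ => 2) v)
    (huv : ∃! j : Fin d → Fin 2, u j ≠ v j) :
    IsAperiodic ϱ.hull := by
  intro x hx n hper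
  by_contra hn
  obtain ⟨i₀, -⟩ := Function.ne_iff.1 hn
  have : Nonempty (Fin d) := ⟨i₀⟩
  obtain ⟨j, hj, huniq⟩ := huv
  -- The sum bounds every `|n i|`, and `K < 2 ^ K ≤ L i ^ K`.
  let K := ∑ i, (n i).natAbs
  have hK : ∀ i, (n i).natAbs < ϱ.L i ^ K := fun i =>
    calc (n i).natAbs ≤ K :=
          Finset.single_le_sum (f := fun i => (n i).natAbs) (fun _ _ => Nat.zero_le _)
            (Finset.mem_univ i)
      _ < 2 ^ K := Nat.lt_two_pow_self
      _ ≤ ϱ.L i ^ K := Nat.pow_le_pow_left (ϱ.two_le_L i) K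
  obtain ⟨y, y', j', hne, hy, hy', hyy'⟩ := exists_move_innermost_corner _ n hK hn j
  obtain ⟨s, hs⟩ := hprim.exists_occurrence_of_isLegal hx hu K
  obtain ⟨s', hs'⟩ := hprim.exists_occurrence_of_isLegal hx hv K
  have hshift : ∀ s : Fin d → ℤ, x (fun i => s i + y i) = x (fun i => s i + y' i) := by
    intro s
    rcases hyy' with h | h
    · rw [← congrFun hper fun i => s i + y i]
      refine congrArg x (funext fun i => ?_)
      simp only [Pi.add_apply, h]
      ring
    · rw [← congrFun hper fun i => s i + y' i]
      refine congrArg x (funext fun i => ?_)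
      simp only [Pi.add_apply, h]
      ring
  have huv' : u j' = v j' := by
    by_contra h
    exact hne (huniq j' h)
  -- It remains to compare the two patterns at `y`; `hshift` carries both letters to `y'`, in box
  -- `j' ≠ j`.
  refine hj (hbij.letterAt_injective K y ?_)
  change ϱ.letterAt K (u j) y = ϱ.letterAt K (v j) y
  rw [← hs j y hy, ← hs' j y hy, hshift, hshift, hs j' y' hy', hs' j' y' hy', huv']
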